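/- Let $P\subset\mathbb{R}^3$ be a fullerene isomer with $n$ vertices (a $C_n$-isomer), that is, a simple, compact, convex, three-dimensional polytope with $n$ vertices, each of whose facets is a pentagon or a hexagon, with exactly $12$ pentagonal facets. Write $P=\{x\in\mathbb{R}^3 : \langle a_i,x\rangle+b_i\ge 0,\ i=1,\dots,m\}$ with $a_i\ne 0$, where $f_i=\{x\in P : \langle a_i,x\rangle+b_i=0\}$, $i=1,\dots,m$, are the pairwise distinct facets of $P$. Let $T_n$ be the dual facet graph of $P$: its vertices are the facets of $P$, and two different facets are adjacent if and only if they share an edge of $P$. Let $T_n^5$ and $T_n^6$ be the subgraphs of $T_n$ induced on the pentagonal facets and on the hexagonal facets, respectively. Then $$|E(T_n^6)| = |E(T_n^5)| + \frac{3n}{2} - 60 .$$ -/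

import Mathlib

namespace Fullerene

/-- Euclidean three-space. -/
abbrev E3 : Type := EuclideanSpace ℝ (Fin 3)

/-- The data of `m` closed half-spaces `{x | ⟪a i, x⟫ + b i ≥ 0}` of three-space. -/
structure HalfspaceSystem (m : ℕ) where
  a : Fin m → E3
  b : Fin m → ℝ

namespace HalfspaceSystem

variable {m : ℕ} (H : HalfspaceSystem m)

/-- The intersection `P = {x | ⟪a i, x⟫ + b i ≥ 0 for all i}` of the half-spaces. -/
def carrier : Set E3 := {x | ∀ i, 0 ≤ inner ℝ (H.a i) x + H.b i}

/-- The set `f i = {x | ⟪a i, x⟫ + b i = 0} ∩ P`. -/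
def facet (i : Fin m) : Set E3 := {x | inner ℝ (H.a i) x + H.b i = 0} ∩ H.carrier

/-- `P` is a compact convex polytope with non-empty interior, and the sets `f 1, …, f m` are
pairwise distinct facets (two-dimensional faces) of it: the description of `P` by the
half-spaces is irredundant, so `f 1, …, f m` is the list of all facets of `P`. -/
structure IsPolytope : Prop where
  a_ne_zero : ∀ i, H.a i ≠ 0
  isCompact_carrier : IsCompact H.carrier
  interior_nonempty : (interior H.carrier).Nonempty
  facet_dim : ∀ i, Module.finrank ℝ (vectorSpan ℝ (H.facet i)) = 2
  facet_injective : Function.Injective H.facet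

/-- The vertices of `P`. -/
def vertices : Set E3 := Set.extremePoints ℝ H.carrier

/-- `e` is an edge of `P`, that is, a one-dimensional face. -/
def IsEdge (e : Set E3) : Prop :=
  IsExposed ℝ H.carrier e ∧ Module.finrank ℝ (vectorSpan ℝ e) = 1

/-- `P` is simple: every vertex lies in exactly three facets. -/
def IsSimple : Prop := ∀ v ∈ H.vertices, {i | v ∈ H.facet i}.ncard = 3

/-- The `i`-th facet is a `k`-gon: as a convex polygon it has exactly `k` vertices. -/
def IsGon (k : ℕ) (i : Fin m) : Prop := (Set.extremePoints ℝ (H.facet i)).ncard = k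

/-- `P` is a fullerene isomer with `n` vertices (a `C_n`-isomer): a simple polytope, each of whose
facets is a pentagon or a hexagon, with exactly `12` pentagons. -/
structure IsFullereneIsomer (n : ℕ) : Prop where
  isPolytope : H.IsPolytope
  isSimple : H.IsSimple
  card_vertices : H.vertices.ncard = n
  pentagon_or_hexagon : ∀ i, H.IsGon 5 i ∨ H.IsGon 6 i
  card_pentagons : {i | H.IsGon 5 i}.ncard = 12

/-- The dual facet graph: two different facets are adjacent if they share an edge of `P`. -/
def dualGraph : SimpleGraph (Fin m) where
  Adj i j := i ≠ j ∧ ∃ e, H.IsEdge e ∧ e ⊆ H.facet i ∧ e ⊆ H.facet j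
  symm := ⟨fun _ _ h => ⟨h.1.symm, h.2.imp fun _ he => ⟨he.1, he.2.2, he.2.1⟩⟩⟩
  loopless := ⟨fun _ h => h.1 rfl⟩

/-- The subgraph of the dual facet graph induced on the set of facets that are `k`-gons. -/
def gonGraph (k : ℕ) : SimpleGraph {i : Fin m | H.IsGon k i} :=
  H.dualGraph.induce {i : Fin m | H.IsGon k i}

end HalfspaceSystem

end Fullerene

open Set

namespace Fullerene

/-! The proof is double counting and never needs Euler's formula. In a simple polytope, two distinct
facets with a common vertex meet in an edge with exactly two vertices (`facet_inter_facet`).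
Counting pairs (vertex of a facet, another facet through it) then shows that a facet with k vertices
has degree k in the dual graph (`ncard_neighborSet`).

Let h be the number of hexagons. Summing degrees over pentagons and over hexagons, the mixed
adjacencies cancel, so 2|E6| + 60 = 2|E5| + 6h. Each vertex lies on three facets, so 60 + 6h = 3n.
Eliminating h gives the claim. -/

theorem _root_.AffineMap.extremePoints_image {E F : Type*} [AddCommGroup E] [Module ℝ E]
    [AddCommGroup F] [Module ℝ F] (f : E →ᵃ[ℝ] F) (hf : Function.Injective f) (s : Set E) :
    extremePoints ℝ (f '' s) = f '' extremePoints ℝ s := by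
  have key : ∀ x y z, f z ∈ openSegment ℝ (f x) (f y) ↔ z ∈ openSegment ℝ x y := by
    intro x y z
    rw [← image_openSegment ℝ f x y, hf.mem_set_image]
  ext w
  constructor
  · rintro ⟨⟨z, hz, rfl⟩, h⟩
    refine ⟨z, ⟨hz, fun x hx y hy hxy => hf ?_⟩, rfl⟩
    exact h (mem_image_of_mem f hx) (mem_image_of_mem f hy) ((key x y z).2 hxy)
  · rintro ⟨z, ⟨hz, h⟩, rfl⟩
    refine ⟨mem_image_of_mem f hz, ?_⟩
    rintro _ ⟨x, hx, rfl⟩ _ ⟨y, hy, rfl⟩ hxy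
    rw [h hx hy ((key x y z).1 hxy)]

/-- A nondegenerate compact convex subset of a line has exactly two extreme points. -/
theorem ncard_extremePoints_of_subset_line {F : Set E3} (hc : IsCompact F) (hconv : Convex ℝ F)
    {v d : E3} (hd : d ≠ 0) (hv : v ∈ F) (hline : ∀ x ∈ F, ∃ t : ℝ, x = v + t • d)
    {ε : ℝ} (hε : ε ≠ 0) (hvε : v + ε • d ∈ F) : (extremePoints ℝ F).ncard = 2 := by
  set f : ℝ →ᵃ[ℝ] E3 := AffineMap.lineMap v (v + d) with hfdef
  have hf : ∀ t, f t = v + t • d := fun t => by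
    simp [hfdef, AffineMap.lineMap_apply, add_comm]
  have hinj : Function.Injective f := by
    intro s t h
    rw [hf, hf] at h
    exact smul_left_injective ℝ hd (add_left_cancel h)
  have himage : f '' (f ⁻¹' F) = F := by
    rw [image_preimage_eq_iff]
    intro x hx
    obtain ⟨t, rfl⟩ := hline x hx
    exact ⟨t, hf t⟩
  have hfcont : Continuous f := f.continuous_of_finiteDimensional
  have hconv' : Convex ℝ (f ⁻¹' F) := hconv.affine_preimage f
  have h0 : (0 : ℝ) ∈ f ⁻¹' F := by simpa [hf] using hv
  have hε' : ε ∈ f ⁻¹' F := by simpa [hf] using hvε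
  have hemb : Topology.IsClosedEmbedding f := by
    have : Topology.IsClosedEmbedding f.linear :=
      LinearMap.isClosedEmbedding_of_injective
        (LinearMap.ker_eq_bot.2 (f.linear_injective_iff.2 hinj))
    have h2 := (Homeomorph.addRight (f 0)).isClosedEmbedding.comp this
    convert! h2 using 1
    ext1 t
    exact congrFun f.decomp t
  have hc' : IsCompact (f ⁻¹' F) := hemb.isCompact_preimage hc
  -- In the coordinate t the set is a compact interval; it contains both 0 and ε ≠ 0, so its
  -- endpoints differ.
  have hIcc := eq_Icc_of_connected_compact ⟨⟨0, h0⟩, hconv'.isPreconnected⟩ hc'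
  rw [hIcc] at h0 hε' himage
  set p := sInf (f ⁻¹' F)
  set q := sSup (f ⁻¹' F)
  have hpq : p ≠ q := by
    intro h
    rw [h, Icc_self, mem_singleton_iff] at h0 hε'
    exact hε (hε'.trans h0.symm)
  rw [← himage, f.extremePoints_image hinj, extremePoints_Icc (h0.1.trans h0.2),
    ncard_image_of_injective _ hinj, ncard_pair hpq]

/-! ### Facets, edges and vertices of a simple polytope -/

namespace HalfspaceSystem

variable {m : ℕ} {P : HalfspaceSystem m}

theorem isExposed_facet (P : HalfspaceSystem m) (i : Fin m) :
    IsExposed ℝ P.carrier (P.facet i) := by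
  rintro ⟨w, hw, hwP⟩
  rw [mem_ofPred_eq] at hw
  -- Exposed faces are sets of maximizers, while the facet minimizes the inner product with `P.a i`;
  -- hence the sign.
  refine ⟨-(innerSL ℝ (P.a i)), ?_⟩
  ext x
  simp only [facet, mem_inter_iff, mem_ofPred_eq, neg_apply,
    innerSL_apply_apply, neg_le_neg_iff]
  constructor
  · rintro ⟨hx, hxP⟩
    exact ⟨hxP, fun y hy => by linarith [hy i]⟩
  · rintro ⟨hxP, hx⟩
    refine ⟨le_antisymm ?_ (hxP i), hxP⟩
    have := hx w hwP
    linarith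

theorem convex_carrier (P : HalfspaceSystem m) : Convex ℝ P.carrier := by
  intro x hx y hy s t hs ht hst i
  rw [inner_add_right, inner_smul_right, inner_smul_right]
  have h1 := mul_nonneg hs (hx i)
  have h2 := mul_nonneg ht (hy i)
  have : P.b i = s * P.b i + t * P.b i := by rw [← add_mul, hst, one_mul]
  linarith

/-- Extreme points of a face are extreme in the whole body. This turns the polygon condition `IsGon`
into a count of vertices of `P`. -/
theorem extremePoints_facet (P : HalfspaceSystem m) (i : Fin m) :
    extremePoints ℝ (P.facet i) = P.facet i ∩ P.vertices :=
  (P.isExposed_facet i).isExtreme.extremePoints_eq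

/-- Two facets sharing a point have linearly independent normals. -/
theorem IsPolytope.linearIndependent_pair (hP : P.IsPolytope) {i j : Fin m} (hij : i ≠ j)
    {v : E3} (hi : v ∈ P.facet i) (hj : v ∈ P.facet j) :
    LinearIndependent ℝ ![P.a i, P.a j] := by
  rw [LinearIndependent.pair_iff' (hP.a_ne_zero i)]
  intro c hc
  have hi0 := hi.1
  have hj0 := hj.1
  rw [mem_ofPred_eq] at hi0 hj0
  rw [← hc, inner_smul_left] at hj0
  have hc0 : c ≠ 0 := by
    rintro rfl
    exact hP.a_ne_zero j (by rw [← hc, zero_smul])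
  -- Both constraints are tight at `v`, so proportional normals force proportional offsets. The two
  -- planes then coincide, whatever the sign of `c`.
  have hb : P.b j = c * P.b i := by
    simp only [conj_trivial] at hj0
    linear_combination hj0 - c * hi0
  refine hij (hP.facet_injective ?_)
  ext x
  simp only [facet, mem_inter_iff, mem_ofPred_eq, and_congr_left_iff]
  intro _
  rw [← hc, inner_smul_left, hb]
  simp only [conj_trivial]
  rw [← mul_add, mul_eq_zero, or_iff_right hc0]

/-- The orthogonal complement of a plane in three-space is a line; `d` spans it. -/
theorem exists_direction {a b : E3} (h : LinearIndependent ℝ ![a, b]) :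
    ∃ d : E3, d ≠ 0 ∧ inner ℝ a d = 0 ∧ inner ℝ b d = 0 ∧
      ∀ x : E3, inner ℝ a x = 0 → inner ℝ b x = 0 → ∃ t : ℝ, x = t • d := by
  have hrange : range ![a, b] = {a, b} := by simp [Matrix.range_cons, Matrix.range_empty, pair_comm]
  have hfr : Module.finrank ℝ (Submodule.span ℝ {a, b}) = 2 := by
    rw [← hrange, finrank_span_eq_card h, Fintype.card_fin]
  have hfo : Module.finrank ℝ (Submodule.span ℝ {a, b})ᗮ = 1 :=
    Submodule.finrank_add_finrank_orthogonal' (by rw [hfr, finrank_euclideanSpace_fin])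
  have hmem : ∀ x : E3, x ∈ (Submodule.span ℝ {a, b})ᗮ ↔ inner ℝ a x = 0 ∧ inner ℝ b x = 0 := by
    intro x
    rw [Submodule.mem_orthogonal]
    constructor
    · intro hx
      exact ⟨hx a (Submodule.subset_span (by simp)), hx b (Submodule.subset_span (by simp))⟩
    · rintro ⟨ha, hb⟩ u hu
      obtain ⟨s, t, rfl⟩ := Submodule.mem_span_pair.1 hu
      rw [inner_add_left, inner_smul_left, inner_smul_left, ha, hb]
      simp
  obtain ⟨⟨d, hd⟩, hd0, hspan⟩ := finrank_eq_one_iff'.1 hfo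
  refine ⟨d, fun h0 => hd0 (Subtype.ext h0), ((hmem d).1 hd).1, ((hmem d).1 hd).2, ?_⟩
  intro x hxa hxb
  obtain ⟨t, ht⟩ := hspan ⟨x, (hmem x).2 ⟨hxa, hxb⟩⟩
  exact ⟨t, (congrArg Subtype.val ht).symm⟩

/-- Leaving a point of `P` in a direction that decreases none of the tight constraints, one stays
in `P` for a while. -/
theorem exists_pos_add_smul_mem {v d : E3} (hv : v ∈ P.carrier)
    (hd : ∀ i, v ∈ P.facet i → 0 ≤ inner ℝ (P.a i) d) :
    ∃ ε : ℝ, 0 < ε ∧ v + ε • d ∈ P.carrier := by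
  -- Slack constraints survive small steps by continuity, and there are only finitely many
  -- constraints.
  have hev : ∀ i, ∀ᶠ ε : ℝ in nhdsWithin 0 (Ioi 0),
      0 ≤ inner ℝ (P.a i) (v + ε • d) + P.b i := by
    intro i
    by_cases hi : v ∈ P.facet i
    · filter_upwards [self_mem_nhdsWithin] with ε hε
      rw [inner_add_right, inner_smul_right]
      have h1 := mul_nonneg (le_of_lt hε) (hd i hi)
      have := hv i
      linarith
    · have hpos : 0 < inner ℝ (P.a i) v + P.b i :=
        lt_of_le_of_ne (hv i) fun h => hi ⟨h.symm, hv⟩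
      have hcont : Continuous fun ε : ℝ => inner ℝ (P.a i) (v + ε • d) + P.b i := by fun_prop
      have := hcont.continuousAt (x := 0) |>.eventually_const_lt (by simpa using hpos)
      filter_upwards [nhdsWithin_le_nhds this] with ε hε using hε.le
  obtain ⟨ε, hε, hpos⟩ := ((Filter.eventually_all.2 hev).and self_mem_nhdsWithin).exists
  exact ⟨ε, hpos, hε⟩

/-- In a simple polytope, two facets that share a vertex meet in an edge with two vertices. -/
theorem IsPolytope.facet_inter_facet (hP : P.IsPolytope) (hs : P.IsSimple) {i j : Fin m}
    (hij : i ≠ j) {v : E3} (hv : v ∈ P.vertices) (hi : v ∈ P.facet i) (hj : v ∈ P.facet j) :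
    P.IsEdge (P.facet i ∩ P.facet j) ∧ (P.facet i ∩ P.facet j ∩ P.vertices).ncard = 2 := by
  have hexp := (P.isExposed_facet i).inter (P.isExposed_facet j)
  obtain ⟨d, hd0, hid, hjd, hspan⟩ := exists_direction (hP.linearIndependent_pair hij hi hj)
  have hdiff : ∀ x ∈ P.facet i ∩ P.facet j, ∃ t : ℝ, x - v = t • d := by
    rintro x ⟨hxi, hxj⟩
    have h1 := hxi.1
    have h2 := hxj.1
    have h3 := hi.1
    have h4 := hj.1
    rw [mem_ofPred_eq] at h1 h2 h3 h4
    exact hspan _ (by rw [inner_sub_right]; linarith) (by rw [inner_sub_right]; linarith)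
  obtain ⟨k, hk⟩ : ∃ k, ∀ l, v ∈ P.facet l → l = i ∨ l = j ∨ l = k := by
    obtain ⟨x, y, z, -, -, -, hxyz⟩ := ncard_eq_three.1 (hs v hv)
    have hmem : ∀ l, v ∈ P.facet l ↔ l = x ∨ l = y ∨ l = z := fun l => by
      rw [← mem_ofPred_eq (p := fun l => v ∈ P.facet l), hxyz]; simp
    have h1 := (hmem i).1 hi
    have h2 := (hmem j).1 hj
    simp only [hmem]
    clear * - hij h1 h2
    rcases h1 with h1 | h1 | h1 <;> rcases h2 with h2 | h2 | h2 <;>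
      first
      | exact absurd (h1.trans h2.symm) hij
      | exact ⟨x, by grind⟩
      | exact ⟨y, by grind⟩
      | exact ⟨z, by grind⟩
  -- Simplicity leaves one further tight constraint `k`, so one of the directions d, -d does not
  -- decrease it. Moving that way stays in `P`, so the intersection is more than a point.
  obtain ⟨σ, hσ, hkd⟩ : ∃ σ : ℝ, σ ≠ 0 ∧ 0 ≤ inner ℝ (P.a k) (σ • d) := by
    rcases le_total 0 (inner ℝ (P.a k) d) with h | h
    · exact ⟨1, one_ne_zero, by simpa using h⟩
    · exact ⟨-1, by norm_num, by simpa using h⟩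
  obtain ⟨ε, hε, hmem⟩ := exists_pos_add_smul_mem (d := σ • d) hi.2 (by
    intro l hl
    rcases hk l hl with rfl | rfl | rfl
    · rw [inner_smul_right, hid, mul_zero]
    · rw [inner_smul_right, hjd, mul_zero]
    · exact hkd)
  have hF : v + (ε * σ) • d ∈ P.facet i ∩ P.facet j := by
    rw [← smul_smul]
    refine ⟨⟨?_, hmem⟩, ⟨?_, hmem⟩⟩
    · rw [mem_ofPred_eq, smul_smul, inner_add_right, inner_smul_right, hid, mul_zero, add_zero]
      exact hi.1
    · rw [mem_ofPred_eq, smul_smul, inner_add_right, inner_smul_right, hjd, mul_zero, add_zero]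
      exact hj.1
  have hεσ : ε * σ ≠ 0 := mul_ne_zero hε.ne' hσ
  have hvF : v ∈ P.facet i ∩ P.facet j := ⟨hi, hj⟩
  refine ⟨⟨hexp, ?_⟩, ?_⟩
  · have hspan_eq : vectorSpan ℝ (P.facet i ∩ P.facet j) = Submodule.span ℝ {d} := by
      apply le_antisymm
      · rw [vectorSpan_eq_span_vsub_set_right ℝ hvF, Submodule.span_le]
        rintro _ ⟨x, hx, rfl⟩
        obtain ⟨t, ht⟩ := hdiff x hx
        exact Submodule.mem_span_singleton.2 ⟨t, ht.symm⟩
      · rw [Submodule.span_singleton_le_iff_mem]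
        have h := vsub_mem_vectorSpan ℝ hF hvF
        rw [vsub_eq_sub, add_sub_cancel_left] at h
        exact (Submodule.smul_mem_iff _ hεσ).1 h
    rw [hspan_eq, finrank_span_singleton hd0]
  · rw [vertices, ← hexp.isExtreme.extremePoints_eq]
    refine ncard_extremePoints_of_subset_line (hexp.isCompact hP.isCompact_carrier)
      (hexp.convex P.convex_carrier) hd0 hvF ?_ hεσ hF
    intro x hx
    obtain ⟨t, ht⟩ := hdiff x hx
    exact ⟨t, by rw [← ht]; abel⟩

/-- A shared edge is compact and nonempty, so it has an extreme point, which is a vertex of `P`.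
Conversely, simplicity makes the intersection at a shared vertex an edge. -/
theorem IsPolytope.dualGraph_adj_iff (hP : P.IsPolytope) (hs : P.IsSimple) {i j : Fin m} :
    P.dualGraph.Adj i j ↔ i ≠ j ∧ (P.facet i ∩ P.facet j ∩ P.vertices).Nonempty := by
  constructor
  · rintro ⟨hij, e, ⟨he, hdim⟩, hei, hej⟩
    refine ⟨hij, ?_⟩
    have hne : e.Nonempty := by
      rw [nonempty_iff_ne_empty]
      rintro rfl
      rw [vectorSpan_empty, finrank_bot] at hdim
      exact zero_ne_one hdim
    obtain ⟨v, hv⟩ := (he.isCompact hP.isCompact_carrier).extremePoints_nonempty hne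
    rw [he.isExtreme.extremePoints_eq] at hv
    exact ⟨v, ⟨hei hv.1, hej hv.1⟩, hv.2⟩
  · rintro ⟨hij, v, ⟨hi, hj⟩, hv⟩
    exact ⟨hij, _, (hP.facet_inter_facet hs hij hv hi hj).1, inter_subset_left,
      inter_subset_right⟩

/-- The number of neighbours of a facet is the number of its vertices. -/
theorem IsPolytope.ncard_neighborSet (hP : P.IsPolytope) (hs : P.IsSimple)
    (hfin : P.vertices.Finite) (i : Fin m) :
    (P.dualGraph.neighborSet i).ncard = (P.facet i ∩ P.vertices).ncard := by
  classical
  have hfin' : (P.facet i ∩ P.vertices).Finite := hfin.subset inter_subset_right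
  set V := hfin'.toFinset with hV
  have hcount := Finset.sum_card_bipartiteAbove_eq_sum_card_bipartiteBelow
    (s := V) (t := Finset.univ.erase i) (fun v j => v ∈ P.facet j)
  -- Of the three facets through a vertex, two remain after `i` is removed.
  have hleft : ∀ v ∈ V, ((Finset.univ.erase i).bipartiteAbove (fun v j => v ∈ P.facet j) v).card
      = 2 := by
    intro v hv
    rw [hV, Finite.mem_toFinset] at hv
    have h3 := hs v hv.2
    rw [ncard_eq_toFinset_card', toFinset_ofPred] at h3
    have : (Finset.univ.erase i).bipartiteAbove (fun v j => v ∈ P.facet j) v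
        = (Finset.univ.filter fun j => v ∈ P.facet j).erase i := by
      ext j; simp [Finset.bipartiteAbove]
    rw [this, Finset.card_erase_of_mem (by simpa using hv.1), h3]
  have hright : ∀ j ∈ Finset.univ.erase i, (V.bipartiteBelow (fun v j => v ∈ P.facet j) j).card
      = if P.dualGraph.Adj i j then 2 else 0 := by
    intro j hj
    have hset : (V.bipartiteBelow (fun v j => v ∈ P.facet j) j : Set E3)
        = P.facet i ∩ P.facet j ∩ P.vertices := by
      ext v; simp [Finset.bipartiteBelow, hV]; tauto
    rw [← ncard_coe_finset, hset]
    have hij : i ≠ j := (Finset.ne_of_mem_erase hj).symm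
    split_ifs with hadj
    · obtain ⟨-, v, ⟨hi, hj⟩, hv⟩ := (hP.dualGraph_adj_iff hs).1 hadj
      exact (hP.facet_inter_facet hs hij hv hi hj).2
    · rw [hP.dualGraph_adj_iff hs, not_and, not_nonempty_iff_eq_empty] at hadj
      rw [hadj hij, ncard_empty]
  rw [Finset.sum_congr rfl hleft, Finset.sum_congr rfl hright, Finset.sum_const,
    Finset.sum_ite, Finset.sum_const, Finset.sum_const_zero, add_zero, smul_eq_mul,
    smul_eq_mul] at hcount
  rw [ncard_eq_toFinset_card _ hfin', ← Nat.eq_of_mul_eq_mul_right two_pos hcount.symm,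
    ← ncard_coe_finset]
  congr 1
  ext j
  simpa using fun h : P.dualGraph.Adj i j => h.ne'

/-- In a simple polytope every vertex is counted three times over the facets. -/
theorem IsSimple.sum_ncard_facet_vertices (hs : P.IsSimple) (hfin : P.vertices.Finite) :
    ∑ i, (P.facet i ∩ P.vertices).ncard = 3 * P.vertices.ncard := by
  classical
  have hcount := Finset.sum_card_bipartiteAbove_eq_sum_card_bipartiteBelow
    (s := hfin.toFinset) (t := Finset.univ) (fun v j => v ∈ P.facet j)
  have hleft : ∀ v ∈ hfin.toFinset,
      (Finset.univ.bipartiteAbove (fun v j => v ∈ P.facet j) v).card = 3 := by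
    intro v hv
    rw [← hs v (hfin.mem_toFinset.1 hv), ncard_eq_toFinset_card', toFinset_ofPred,
      Finset.bipartiteAbove]
  rw [Finset.sum_congr rfl hleft, Finset.sum_const, smul_eq_mul,
    ← ncard_eq_toFinset_card _ hfin, mul_comm] at hcount
  rw [hcount]
  refine Finset.sum_congr rfl fun j _ => ?_
  rw [← ncard_coe_finset]
  congr 1
  ext v; simp [Finset.bipartiteBelow, and_comm]

end HalfspaceSystem

/-! ### Counting edges across a bipartition of a graph -/

/-- Twice the number of edges of an induced subgraph is the number of ordered pairs of adjacent
vertices in it. -/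
theorem sum_ncard_neighborSet_inter {α : Type*} [Fintype α] [DecidableEq α] (G : SimpleGraph α)
    (s : Finset α) :
    ∑ i ∈ s, (G.neighborSet i ∩ s).ncard = 2 * (G.induce (s : Set α)).edgeSet.ncard := by
  classical
  have h := (G.induce (s : Set α)).sum_degrees_eq_twice_card_edges
  rw [← SimpleGraph.coe_edgeFinset, ncard_coe_finset, ← h,
    Finset.sum_subtype s (p := (· ∈ (s : Set α))) (fun x => Finset.mem_coe.symm)]
  refine Finset.sum_congr rfl fun i _ => ?_
  rw [← SimpleGraph.card_neighborFinset_eq_degree, ← ncard_coe_finset,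
    ← ncard_image_of_injective _ Subtype.val_injective]
  congr 1
  ext j
  simp [and_comm]

theorem sum_ncard_neighborSet_inter_comm {α : Type*} [Finite α] (G : SimpleGraph α)
    (s t : Finset α) :
    ∑ i ∈ s, (G.neighborSet i ∩ t).ncard = ∑ j ∈ t, (G.neighborSet j ∩ s).ncard := by
  classical
  convert! Finset.sum_card_bipartiteAbove_eq_sum_card_bipartiteBelow (s := s) (t := t) G.Adj
    using 2 with i hi j hj
  · rw [← ncard_coe_finset]
    congr 1
    ext j
    simp [Finset.bipartiteAbove, and_comm]
  · rw [← ncard_coe_finset]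
    congr 1
    ext i
    simp [Finset.bipartiteBelow, and_comm, G.adj_comm]

/-- If every vertex has degree `a` on `s` and `b` off `s`, the numbers of edges inside the two parts
determine one another. -/
theorem two_mul_ncard_edgeSet_induce_compl {α : Type*} [Fintype α] [DecidableEq α]
    (G : SimpleGraph α) (s : Finset α) {a b : ℕ} (ha : ∀ i ∈ s, (G.neighborSet i).ncard = a)
    (hb : ∀ i ∈ sᶜ, (G.neighborSet i).ncard = b) :
    2 * (G.induce (sᶜ : Finset α)).edgeSet.ncard + s.card * a
      = 2 * (G.induce (s : Set α)).edgeSet.ncard + sᶜ.card * b := by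
  have hsplit : ∀ i, (G.neighborSet i ∩ s).ncard + (G.neighborSet i ∩ (sᶜ : Finset α)).ncard
      = (G.neighborSet i).ncard := fun i => by
    rw [Finset.coe_compl, ← sdiff_eq, ncard_inter_add_ncard_sdiff_eq_ncard]
  have hs : s.card * a = ∑ i ∈ s, (G.neighborSet i ∩ s).ncard
      + ∑ i ∈ s, (G.neighborSet i ∩ (sᶜ : Finset α)).ncard := by
    rw [← Finset.sum_add_distrib, Finset.sum_congr rfl fun i hi => (hsplit i).trans (ha i hi),
      Finset.sum_const, smul_eq_mul]
  have ht : sᶜ.card * b = ∑ i ∈ sᶜ, (G.neighborSet i ∩ s).ncard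
      + ∑ i ∈ sᶜ, (G.neighborSet i ∩ (sᶜ : Finset α)).ncard := by
    rw [← Finset.sum_add_distrib, Finset.sum_congr rfl fun i hi => (hsplit i).trans (hb i hi),
      Finset.sum_const, smul_eq_mul]
  rw [sum_ncard_neighborSet_inter] at hs ht
  rw [sum_ncard_neighborSet_inter_comm] at hs
  omega

/-- `ncard` is 0 on infinite sets, so `card_vertices` alone does not give finiteness when n = 0. The
facet counts 5 and 6 are nonzero, and every vertex lies on one of the finitely many facets. -/
theorem HalfspaceSystem.IsFullereneIsomer.finite_vertices {m n : ℕ} {P : HalfspaceSystem m}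
    (hP : P.IsFullereneIsomer n) : P.vertices.Finite := by
  refine (finite_iUnion (f := fun i => extremePoints ℝ (P.facet i)) fun i => ?_).subset ?_
  · apply finite_of_ncard_ne_zero
    rcases hP.pentagon_or_hexagon i with h | h <;> rw [HalfspaceSystem.IsGon] at h <;> omega
  · intro v hv
    obtain ⟨i, hi⟩ : {i | v ∈ P.facet i}.Nonempty := by
      apply nonempty_of_ncard_ne_zero
      rw [hP.isSimple v hv]
      norm_num
    exact mem_iUnion.2 ⟨i, by rw [P.extremePoints_facet]; exact ⟨hi, hv⟩⟩

end Fullerene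

theorem mainTheorem3 {m n : ℕ} (P : Fullerene.HalfspaceSystem m) (hP : P.IsFullereneIsomer n) :
    ((P.gonGraph 6).edgeSet.ncard : ℚ)
      = ((P.gonGraph 5).edgeSet.ncard : ℚ) + 3 * (n : ℚ) / 2 - 60 := by
  classical
  have hfin := hP.finite_vertices
  set s : Finset (Fin m) := Finset.univ.filter (P.IsGon 5) with hs
  have hs5 : {i | P.IsGon 5 i} = (s : Set (Fin m)) := by simp [hs]
  have hs6 : {i | P.IsGon 6 i} = ((sᶜ : Finset (Fin m)) : Set (Fin m)) := by
    ext i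
    simp only [hs, mem_ofPred_eq, Finset.coe_compl, Finset.coe_filter, Finset.mem_univ, true_and,
      mem_compl_iff]
    have := hP.pentagon_or_hexagon i
    simp only [Fullerene.HalfspaceSystem.IsGon] at this ⊢
    omega
  have hcard : s.card = 12 := by
    rw [← ncard_coe_finset, ← hs5, hP.card_pentagons]
  have h5 : ∀ i ∈ s, (P.facet i ∩ P.vertices).ncard = 5 := fun i hi => by
    rw [← P.extremePoints_facet]
    exact hs5.ge hi
  have h6 : ∀ i ∈ sᶜ, (P.facet i ∩ P.vertices).ncard = 6 := fun i hi => by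
    rw [← P.extremePoints_facet]
    exact hs6.ge hi
  have hdeg := hP.isPolytope.ncard_neighborSet hP.isSimple hfin
  have hedges := Fullerene.two_mul_ncard_edgeSet_induce_compl P.dualGraph s
    (fun i hi => (hdeg i).trans (h5 i hi)) (fun i hi => (hdeg i).trans (h6 i hi))
  have hsum := hP.isSimple.sum_ncard_facet_vertices hfin
  rw [hP.card_vertices, ← Finset.sum_add_sum_compl s, Finset.sum_congr rfl h5,
    Finset.sum_congr rfl h6, Finset.sum_const, Finset.sum_const, smul_eq_mul, smul_eq_mul] at hsum
  rw [Fullerene.HalfspaceSystem.gonGraph, Fullerene.HalfspaceSystem.gonGraph, hs5, hs6]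
  -- Here 120 is 60 from the pentagon degrees plus 60 from the pentagons' share of the vertex count.
  have hnat : 2 * (P.dualGraph.induce ((sᶜ : Finset (Fin m)) : Set (Fin m))).edgeSet.ncard + 120
      = 2 * (P.dualGraph.induce (s : Set (Fin m))).edgeSet.ncard + 3 * n := by omega
  have hrat : (2 : ℚ) * (P.dualGraph.induce ((sᶜ : Finset (Fin m)) : Set (Fin m))).edgeSet.ncard
      + 120 = 2 * (P.dualGraph.induce (s : Set (Fin m))).edgeSet.ncard + 3 * n := by
    exact_mod_cast hnat
  linarith
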